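/- Call a finite system of linear inequalities $Ax\le b$ with rational data in $d$ unknowns whose solution set $P\subset\mathbb{R}^d$ is bounded an $\mathcal H$-polytope; its vertex centroid $c(P)$ is the average of its vertices (for $P\neq\emptyset$). For $\epsilon>0$, a point $p$ is called an $\epsilon$-approximation of $c(P)$ if it lies in the axis-parallel hypercube of side length $2\epsilon$ centred at $c(P)$, i.e. $|p_j-c(P)_j|\le\epsilon$ for all $j$. **Theorem.** There is an oracle algorithm (one program for a random access machine over the integers with logarithmic cost, with access to an oracle that returns the number of vertices of any $\mathcal H$-polytope) that, given a nonempty $\mathcal H$-polytope $P\subseteq[0,1]^d$ described by $m$ inequalities with rational data and a rational number $\epsilon>0$, computes an $\epsilon$-approximation of $c(P)$. The number of oracle calls is bounded by a polynomial in $m$, $d$ and $1/\epsilon$, and the running time (in which each call is charged the length of the query and of the answer) is bounded by a polynomial in $1/\epsilon$ and the binary encoding length of the input $(P,\epsilon)$. -/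

import Mathlib

namespace VertexCentroid

/-! ### Polytopes given by linear inequalities -/

/-- A finite system of linear inequalities `∑ j, coeff i j * x j ≤ rhs i` with rational data,
in `numIneq` inequalities and `dim` unknowns. -/
structure HRep where
  dim : ℕ
  numIneq : ℕ
  coeff : Fin numIneq → Fin dim → ℚ
  rhs : Fin numIneq → ℚ

/-- The polyhedron in `ℝ^dim` described by the system. -/
def HRep.toSet (P : HRep) : Set (Fin P.dim → ℝ) :=
  {x | ∀ i, ∑ j, (P.coeff i j : ℝ) * x j ≤ (P.rhs i : ℝ)}

/-- The described polyhedron is a polytope, that is, bounded (the empty polytope is allowed). -/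
def HRep.IsPolytope (P : HRep) : Prop := Bornology.IsBounded P.toSet

/-- The vertices of the described polyhedron. -/
def HRep.vertices (P : HRep) : Set (Fin P.dim → ℝ) := P.toSet.extremePoints ℝ

/-- The vertex centroid: the average of the (finitely many) vertices. -/
noncomputable def HRep.centroid (P : HRep) : Fin P.dim → ℝ :=
  (P.vertices.ncard : ℝ)⁻¹ • ∑ᶠ v ∈ P.vertices, v

/-- `p` is an `ε`-approximation of the vertex centroid of `P`: it lies in the axis-parallel
hypercube of side length `2 * ε` centred at the vertex centroid. -/
def HRep.IsCentroidApprox (P : HRep) (ε : ℚ) (p : Fin P.dim → ℚ) : Prop :=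
  ∀ j, |(p j : ℝ) - P.centroid j| ≤ (ε : ℝ)

/-- An oracle that returns the number of vertices of every polytope. Nothing is known about its
answers on systems that describe an unbounded polyhedron. -/
def IsVertexCountOracle (O : HRep → ℕ) : Prop :=
  ∀ P : HRep, P.IsPolytope → O P = P.vertices.ncard

/-! ### Encoding lengths -/

/-- The binary length of an integer, including the sign. -/
def len (z : ℤ) : ℕ := z.natAbs.size + 1

/-- The binary length of a rational number, written as a reduced fraction. -/
def lenRat (q : ℚ) : ℕ := len q.num + len q.den

/-- The encoding length of a system of inequalities. -/
def HRep.size (P : HRep) : ℕ :=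
  P.dim + P.numIneq + ∑ i, ((∑ j, lenRat (P.coeff i j)) + lenRat (P.rhs i))

/-! ### A random access machine with a vertex-counting oracle -/

/-- A state of the machine: registers with a fixed name, and a memory that is accessed through
addresses held in registers. All cells hold integers. -/
structure State where
  reg : ℕ → ℤ
  mem : ℕ → ℤ

def State.setReg (s : State) (r : ℕ) (z : ℤ) : State :=
  { s with reg := Function.update s.reg r z }

def State.setMem (s : State) (a : ℕ) (z : ℤ) : State :=
  { s with mem := Function.update s.mem a z }

/-- The fraction stored in the cells `a` (numerator) and `a + 1` (denominator). -/
def State.readRat (s : State) (a : ℕ) : ℚ := (s.mem a : ℚ) / (s.mem (a + 1) : ℚ)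

/-- The system of `m` inequalities in `d` unknowns that is stored from address `a` on, row by row:
each row consists of its `d` coefficients and its right-hand side, two cells for each of these. -/
def State.readHRep (s : State) (d m a : ℕ) : HRep where
  dim := d
  numIneq := m
  coeff := fun i j => s.readRat (a + 2 * ((i : ℕ) * (d + 1) + (j : ℕ)))
  rhs := fun i => s.readRat (a + 2 * ((i : ℕ) * (d + 1) + d))

/-- The number of bits that are handed over in such a query. -/
def State.queryLen (s : State) (d m a : ℕ) : ℕ :=
  d + m + len a + ∑ k ∈ Finset.range (2 * (m * (d + 1))), len (s.mem (a + k))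

/-- Programs of the machine. The arguments of the basic instructions are names of registers
(and an integer literal in `const`). -/
inductive Prog where
  | skip : Prog
  | const (r : ℕ) (z : ℤ) : Prog
  | add (r x y : ℕ) : Prog
  | sub (r x y : ℕ) : Prog
  | mul (r x y : ℕ) : Prog
  | div (r x y : ℕ) : Prog
  | load (r x : ℕ) : Prog
  | store (x y : ℕ) : Prog
  | query (r d m a : ℕ) : Prog
  | seq (c₁ c₂ : Prog) : Prog
  | ite (x : ℕ) (c₁ c₂ : Prog) : Prog
  | loop (x : ℕ) (c : Prog) : Prog

/-- `Exec O c s s' t q`: started in the state `s` and with the oracle `O`, the program `c` halts in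
the state `s'`, after a running time of `t` and with `q` oracle calls. Running time is measured by
the logarithmic cost criterion: an instruction is charged the binary lengths of all numbers and
addresses that it handles, and an oracle call is charged the lengths of the query and the answer. -/
inductive Exec (O : HRep → ℕ) : Prog → State → State → ℕ → ℕ → Prop where
  | skip (s : State) : Exec O .skip s s 1 0
  | const (s : State) (r : ℕ) (z : ℤ) :
      Exec O (.const r z) s (s.setReg r z) (1 + len z) 0
  | add (s : State) (r x y : ℕ) :
      Exec O (.add r x y) s (s.setReg r (s.reg x + s.reg y))
        (1 + len (s.reg x) + len (s.reg y)) 0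
  | sub (s : State) (r x y : ℕ) :
      Exec O (.sub r x y) s (s.setReg r (s.reg x - s.reg y))
        (1 + len (s.reg x) + len (s.reg y)) 0
  | mul (s : State) (r x y : ℕ) :
      Exec O (.mul r x y) s (s.setReg r (s.reg x * s.reg y))
        (1 + len (s.reg x) + len (s.reg y)) 0
  | div (s : State) (r x y : ℕ) :
      Exec O (.div r x y) s (s.setReg r (s.reg x / s.reg y))
        (1 + len (s.reg x) + len (s.reg y)) 0
  | load (s : State) (r x : ℕ) :
      Exec O (.load r x) s (s.setReg r (s.mem (s.reg x).toNat))
        (1 + len (s.reg x) + len (s.mem (s.reg x).toNat)) 0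
  | store (s : State) (x y : ℕ) :
      Exec O (.store x y) s (s.setMem (s.reg x).toNat (s.reg y))
        (1 + len (s.reg x) + len (s.reg y)) 0
  | query (s : State) (r d m a : ℕ) :
      Exec O (.query r d m a) s
        (s.setReg r (O (s.readHRep (s.reg d).toNat (s.reg m).toNat (s.reg a).toNat)))
        (1 + len (s.reg d) + len (s.reg m) + len (s.reg a)
          + s.queryLen (s.reg d).toNat (s.reg m).toNat (s.reg a).toNat
          + len (O (s.readHRep (s.reg d).toNat (s.reg m).toNat (s.reg a).toNat))) 1
  | seq {c₁ c₂ : Prog} {s s₁ s₂ : State} {t₁ t₂ q₁ q₂ : ℕ} :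
      Exec O c₁ s s₁ t₁ q₁ → Exec O c₂ s₁ s₂ t₂ q₂ →
      Exec O (.seq c₁ c₂) s s₂ (t₁ + t₂) (q₁ + q₂)
  | iteTrue {x : ℕ} {c₁ c₂ : Prog} {s s₁ : State} {t q : ℕ} :
      0 < s.reg x → Exec O c₁ s s₁ t q →
      Exec O (.ite x c₁ c₂) s s₁ (1 + len (s.reg x) + t) q
  | iteFalse {x : ℕ} {c₁ c₂ : Prog} {s s₁ : State} {t q : ℕ} :
      ¬ 0 < s.reg x → Exec O c₂ s s₁ t q →
      Exec O (.ite x c₁ c₂) s s₁ (1 + len (s.reg x) + t) q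
  | loopTrue {x : ℕ} {c : Prog} {s s₁ s₂ : State} {t₁ t₂ q₁ q₂ : ℕ} :
      0 < s.reg x → Exec O c s s₁ t₁ q₁ → Exec O (.loop x c) s₁ s₂ t₂ q₂ →
      Exec O (.loop x c) s s₂ (1 + len (s.reg x) + t₁ + t₂) (q₁ + q₂)
  | loopFalse {x : ℕ} {c : Prog} {s : State} :
      ¬ 0 < s.reg x → Exec O (.loop x c) s s (1 + len (s.reg x)) 0

/-! ### Input and output conventions -/

/-- The memory that holds the system `P` from address `0` on, in the layout of `State.readHRep`,
and zeros elsewhere. -/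
def HRep.toMem (P : HRep) (n : ℕ) : ℤ :=
  if h : n / 2 < P.numIneq * (P.dim + 1) then
    let ij := finProdFinEquiv.symm (⟨n / 2, h⟩ : Fin (P.numIneq * (P.dim + 1)))
    let entry : ℚ := Fin.snoc (α := fun _ => ℚ) (P.coeff ij.1) (P.rhs ij.1) ij.2
    if n % 2 = 0 then entry.num else (entry.den : ℤ)
  else 0

/-- The initial state on input `P` and `ε`: the registers `0, 1, 2, 3` hold the dimension, the
number of inequalities, and the numerator and denominator of `ε`; the memory holds `P`. -/
def initState (P : HRep) (ε : ℚ) : State where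
  reg := fun r =>
    if r = 0 then (P.dim : ℤ) else if r = 1 then (P.numIneq : ℤ)
    else if r = 2 then ε.num else if r = 3 then (ε.den : ℤ) else 0
  mem := P.toMem

/-- The final state `s` outputs the vector `p`: starting from the address in register `0`, the
memory holds the entries of `p`, each as a numerator followed by a positive denominator. -/
def State.Outputs {d : ℕ} (s : State) (p : Fin d → ℚ) : Prop :=
  ∀ j : Fin d, 0 < s.mem ((s.reg 0).toNat + 2 * (j : ℕ) + 1) ∧
    p j = s.readRat ((s.reg 0).toNat + 2 * (j : ℕ))

end VertexCentroid

namespace VertexCentroid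

/-! ### Vertices of polyhedra and of their sections -/

/-! The centroid is recovered from vertex counts beyond parallel hyperplanes. Let `N` be the number
of vertices and `k = ⌊1/ε⌋ + 1`. For a fixed coordinate `j`, summing over `0 < i ≤ k` the number of
vertices `v` with `i ≤ k * v j` gives the sum of `⌊k * v j⌋`, as `0 ≤ v j ≤ 1`. Each floor loses
less than 1, so dividing by `k * N` approximates the `j`-th coordinate of the centroid up to `1 / k
≤ ε` (`HRep.abs_countGe_sub_centroid_le`).

To count vertices on one side of a hyperplane `f = c`, cut with the halfspace `f ≤ c`. The cut may
create new vertices, but only on the hyperplane, and these are the vertices of the section by `f =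
c`. Hence the number of vertices with `f < c` is the difference of two oracle answers
(`ncard_extremePoints_add`). With one more call for `N` this makes `2 * d * k + 1` calls.

What remains is a program analysis: `Runs` counts instructions against a uniform cell length `L`,
and invariants for three countdown loops give correctness and cost together. All numbers are short,
because a system of `m` inequalities has at most `2 ^ m` vertices. -/

theorem HRep.convex_toSet (P : HRep) : Convex ℝ P.toSet := by
  intro x hx y hy a b ha hb hab i
  have h1 := mul_le_mul_of_nonneg_left (hx i) ha
  have h2 := mul_le_mul_of_nonneg_left (hy i) hb
  have h3 : ∑ j, (P.coeff i j : ℝ) * (a • x + b • y) j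
      = a * ∑ j, (P.coeff i j : ℝ) * x j + b * ∑ j, (P.coeff i j : ℝ) * y j := by
    rw [Finset.mul_sum, Finset.mul_sum, ← Finset.sum_add_distrib]
    refine Finset.sum_congr rfl fun j _ => ?_
    simp only [Pi.add_apply, Pi.smul_apply, smul_eq_mul]
    ring
  rw [h3]
  calc _ ≤ a * (P.rhs i : ℝ) + b * P.rhs i := add_le_add h1 h2
    _ = P.rhs i := by rw [← add_mul, hab, one_mul]

theorem HRep.isClosed_toSet (P : HRep) : IsClosed P.toSet := by
  have : P.toSet = ⋂ i, {x | ∑ j, (P.coeff i j : ℝ) * x j ≤ (P.rhs i : ℝ)} := by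
    ext x; simp [HRep.toSet]
  rw [this]
  exact isClosed_iInter fun i => isClosed_le (by fun_prop) continuous_const

/-- A vertex is the only point of the polyhedron that satisfies all of the inequalities that are
tight at the vertex with equality. -/
theorem HRep.eq_of_tight {P : HRep} {x y : Fin P.dim → ℝ} (hx : x ∈ P.vertices)
    (hy : y ∈ P.toSet)
    (h : ∀ i, ∑ j, (P.coeff i j : ℝ) * x j = P.rhs i → ∑ j, (P.coeff i j : ℝ) * y j = P.rhs i) :
    y = x := by
  have hlin : ∀ (t : ℝ) i, ∑ j, (P.coeff i j : ℝ) * (x + t • (x - y)) j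
      = ∑ j, (P.coeff i j : ℝ) * x j
        + t * (∑ j, (P.coeff i j : ℝ) * x j - ∑ j, (P.coeff i j : ℝ) * y j) := by
    intro t i
    rw [← Finset.sum_sub_distrib, Finset.mul_sum, ← Finset.sum_add_distrib]
    refine Finset.sum_congr rfl fun j _ => ?_
    simp only [Pi.add_apply, Pi.smul_apply, Pi.sub_apply, smul_eq_mul]
    ring
  -- Prolong the segment from `y` slightly beyond `x`: inequalities tight at `x` are tight at `y`
  -- too and stay tight, and slack ones leave room. Then `x` is interior to a segment in the
  -- polyhedron that starts at `y`, so extremality forces `y = x`.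
  have hev : ∀ᶠ t in nhdsWithin (0 : ℝ) (Set.Ioi 0), x + t • (x - y) ∈ P.toSet := by
    refine Filter.eventually_all.2 fun i => ?_
    simp only [hlin]
    rcases (hx.1 i).eq_or_lt with he | hl
    · simp [he, h i he]
    · refine Filter.Eventually.filter_mono nhdsWithin_le_nhds ?_
      have hc : Continuous fun t : ℝ => ∑ j, (P.coeff i j : ℝ) * x j
        + t * (∑ j, (P.coeff i j : ℝ) * x j - ∑ j, (P.coeff i j : ℝ) * y j) := by fun_prop
      exact (hc.tendsto 0).eventually_le_const (by simpa using hl)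
  obtain ⟨t, ht, htpos⟩ := (hev.and self_mem_nhdsWithin).exists
  have htpos : 0 < t := htpos
  refine hx.2 hy ht ⟨t / (1 + t), 1 / (1 + t), by positivity, by positivity,
    by field_simp; exact add_comm _ _, ?_⟩
  ext j
  simp only [Pi.add_apply, Pi.smul_apply, Pi.sub_apply, smul_eq_mul]
  field_simp
  ring

open Classical in
/-- The inequalities that are tight at a point. -/
noncomputable def HRep.tight (P : HRep) (x : Fin P.dim → ℝ) : Finset (Fin P.numIneq) :=
  Finset.univ.filter fun i => ∑ j, (P.coeff i j : ℝ) * x j = P.rhs i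

/-- This gives both the finiteness of the vertex set and the bound `2 ^ m`, which controls the
length of the oracle's answers. -/
theorem HRep.injOn_tight (P : HRep) : Set.InjOn P.tight P.vertices := by
  intro x hx y hy hxy
  refine (HRep.eq_of_tight hx hy.1 fun i hi => ?_).symm
  have : i ∈ P.tight y := hxy ▸ by simpa [HRep.tight] using hi
  simpa [HRep.tight] using this

theorem HRep.finite_vertices (P : HRep) : P.vertices.Finite :=
  Set.Finite.of_injOn (t := Set.univ) (fun _ _ => Set.mem_univ _) P.injOn_tight Set.finite_univ

theorem HRep.ncard_vertices_le (P : HRep) : P.vertices.ncard ≤ 2 ^ P.numIneq := by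
  have := Set.ncard_le_ncard_of_injOn (t := Set.univ) P.tight (fun _ _ => Set.mem_univ _)
    P.injOn_tight Set.finite_univ
  simpa [Set.ncard_univ] using this

theorem HRep.ncard_vertices_pos {P : HRep} (hP : P.IsPolytope) (hne : P.toSet.Nonempty) :
    0 < P.vertices.ncard := by
  have hc : IsCompact P.toSet := Metric.isCompact_of_isClosed_isBounded P.isClosed_toSet hP
  exact (Set.ncard_pos P.finite_vertices).2 (hc.extremePoints_nonempty hne)

/-! ### Vertices of halfspace and hyperplane sections -/

section Sections

variable {E : Type*} [AddCommGroup E] [Module ℝ E] {A : Set E} (f : E →ₗ[ℝ] ℝ) (c : ℝ)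

/-- Extremality is a local property: a segment in `A` around a point with `f x < c` can be shrunk
towards `x` until it lies in the halfspace. -/
theorem extremePoints_halfspace_lt (hA : Convex ℝ A) :
    {x ∈ {x ∈ A | f x ≤ c}.extremePoints ℝ | f x < c} = {x ∈ A.extremePoints ℝ | f x < c} := by
  ext x
  refine and_congr_left fun hx => ⟨fun h => ⟨h.1.1, ?_⟩, fun h => ?_⟩
  · intro y hy z hz hxyz
    -- One factor `δ` for both endpoints, so that `x` divides the shrunken segment with the same
    -- weights.
    obtain ⟨δ, hδ, h0, h1, hfy, hfz⟩ : ∃ δ : ℝ, 0 < δ ∧ 0 ≤ δ ∧ δ ≤ 1 ∧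
        f x + δ * (f y - f x) ≤ c ∧ f x + δ * (f z - f x) ≤ c := by
      have hev : ∀ w : E, ∀ᶠ δ in nhdsWithin (0 : ℝ) (Set.Ioi 0), f x + δ * (f w - f x) ≤ c := by
        intro w
        refine Filter.Eventually.filter_mono nhdsWithin_le_nhds ?_
        have hc : Continuous fun δ : ℝ => f x + δ * (f w - f x) := by fun_prop
        exact (hc.tendsto 0).eventually_le_const (by simpa using hx)
      have h1 : ∀ᶠ δ in nhdsWithin (0 : ℝ) (Set.Ioi 0), δ ≤ 1 :=
        Filter.Eventually.filter_mono nhdsWithin_le_nhds (eventually_le_nhds one_pos)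
      obtain ⟨δ, ⟨⟨hy, hz⟩, h1⟩, h0⟩ :=
        (((hev y).and (hev z)).and h1 |>.and self_mem_nhdsWithin).exists
      exact ⟨δ, h0, le_of_lt h0, h1, hy, hz⟩
    have hmem : ∀ w ∈ A, f x + δ * (f w - f x) ≤ c → x + δ • (w - x) ∈ {x ∈ A | f x ≤ c} :=
      fun w hw hfw => ⟨hA.add_smul_sub_mem h.1.1 hw ⟨h0, h1⟩, by simpa using hfw⟩
    have := h.2 (hmem y hy hfy) (hmem z hz hfz) ?_
    · have h2 : δ • (y - x) = 0 := by simpa using this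
      rcases smul_eq_zero.1 h2 with h3 | h3
      · exact absurd h3 hδ.ne'
      · exact sub_eq_zero.1 h3
    · obtain ⟨a, b, ha, hb, hab, rfl⟩ := hxyz
      refine ⟨a, b, ha, hb, hab, ?_⟩
      obtain rfl : b = 1 - a := by linarith
      module
  · exact inter_extremePoints_subset_extremePoints_of_subset (fun _ h => h.1) ⟨⟨h.1, hx.le⟩, h⟩

/-- The hyperplane section is a face of the halfspace section, and the vertices of a face are the
vertices that lie on it. -/
theorem extremePoints_halfspace_eq :
    {x ∈ {x ∈ A | f x ≤ c}.extremePoints ℝ | f x = c} = {x ∈ A | f x = c}.extremePoints ℝ := by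
  have h : IsExtreme ℝ {x ∈ A | f x ≤ c} {x ∈ A | f x = c} := by
    refine ⟨fun x hx => ⟨hx.1, hx.2.le⟩, ?_⟩
    rintro y ⟨hy, hyc⟩ z ⟨hz, hzc⟩ x ⟨hx, hxc⟩ ⟨a, b, ha, hb, hab, rfl⟩
    refine ⟨hy, le_antisymm hyc ?_⟩
    simp only [map_add, map_smul, smul_eq_mul] at hxc
    obtain rfl : b = 1 - a := by linarith
    nlinarith
  rw [h.extremePoints_eq]
  ext x
  exact ⟨fun ⟨h1, h2⟩ => ⟨⟨h1.1.1, h2⟩, h1⟩, fun ⟨h1, h2⟩ => ⟨h2, h1.2⟩⟩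

/-- The number of vertices on one side of a hyperplane, from the numbers of vertices of the set, of
its intersection with a halfspace, and of its intersection with the hyperplane. -/
theorem ncard_extremePoints_add (hA : Convex ℝ A) (hfin : (A.extremePoints ℝ).Finite)
    (hfin' : ({x ∈ A | f x ≤ c}.extremePoints ℝ).Finite) :
    {x ∈ A.extremePoints ℝ | c ≤ f x}.ncard + ({x ∈ A | f x ≤ c}.extremePoints ℝ).ncard
      = (A.extremePoints ℝ).ncard + ({x ∈ A | f x = c}.extremePoints ℝ).ncard := by
  have h1 : {x ∈ A.extremePoints ℝ | f x < c}.ncard + {x ∈ A.extremePoints ℝ | c ≤ f x}.ncard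
      = (A.extremePoints ℝ).ncard := by
    rw [← Set.ncard_union_eq _ (hfin.subset fun _ h => h.1) (hfin.subset fun _ h => h.1)]
    · congr 1
      ext x
      simp only [Set.mem_union, Set.mem_ofPred_eq, ← and_or_left]
      exact and_iff_left (lt_or_ge _ _)
    · exact Set.disjoint_left.2 fun x hx hx' => absurd hx.2 (not_lt.2 hx'.2)
  -- The vertices of the halfspace section split into old ones with `f x < c` and the vertices of
  -- the hyperplane section.
  have h2 : {x ∈ A.extremePoints ℝ | f x < c}.ncard + ({x ∈ A | f x = c}.extremePoints ℝ).ncard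
      = ({x ∈ A | f x ≤ c}.extremePoints ℝ).ncard := by
    rw [← extremePoints_halfspace_lt f c hA, ← extremePoints_halfspace_eq f c,
      ← Set.ncard_union_eq _ (hfin'.subset fun _ h => h.1) (hfin'.subset fun _ h => h.1)]
    · congr 1
      ext x
      simp only [Set.mem_union, Set.mem_ofPred_eq, ← and_or_left]
      exact ⟨fun h => h.1, fun h => ⟨h, h.1.2.lt_or_eq⟩⟩
    · exact Set.disjoint_left.2 fun x hx hx' => absurd hx.2 (not_lt.2 hx'.2.ge)
  omega

end Sections

/-! ### The centroid from the numbers of vertices beyond hyperplanes -/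

/-- The number of vertices `v` with `i ≤ k * v j`. -/
noncomputable def HRep.countGe (P : HRep) (k : ℕ) (j : Fin P.dim) (i : ℕ) : ℕ :=
  {v ∈ P.vertices | (i : ℝ) ≤ k * v j}.ncard

theorem HRep.countGe_le (P : HRep) (k : ℕ) (j : Fin P.dim) (i : ℕ) :
    P.countGe k j i ≤ P.vertices.ncard :=
  Set.ncard_le_ncard (fun _ h => h.1) P.finite_vertices

/-- Double counting turns the sum of counts into a sum of floors; rounding costs at most 1 per
vertex, hence `1 / k` after division by `k * N`. -/
theorem HRep.abs_countGe_sub_centroid_le {P : HRep} (hne : P.toSet.Nonempty)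
    (hP : P.toSet ⊆ Set.Icc 0 1) {k : ℕ} (hk : 0 < k) (j : Fin P.dim) :
    |((∑ i ∈ Finset.Ioc 0 k, P.countGe k j i : ℕ) : ℝ) / ((k : ℝ) * P.vertices.ncard)
      - P.centroid j| ≤ 1 / k := by
  classical
  have hN := HRep.ncard_vertices_pos (Metric.isBounded_Icc 0 1 |>.subset hP) hne
  set V := P.finite_vertices.toFinset with hV
  have hcard : P.vertices.ncard = V.card := Set.ncard_eq_toFinset_card _ P.finite_vertices
  have hcount : ∀ i, P.countGe k j i = (V.filter fun v => (i : ℝ) ≤ k * v j).card := by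
    intro i
    rw [HRep.countGe, ← Set.ncard_coe_finset]
    congr 1
    ext v
    simp [hV]
  have hsum : ∑ i ∈ Finset.Ioc 0 k, P.countGe k j i = ∑ v ∈ V, ⌊(k : ℝ) * v j⌋₊ := by
    simp_rw [hcount, Finset.card_filter]
    rw [Finset.sum_comm]
    refine Finset.sum_congr rfl fun v hv => ?_
    have hv' := hP (P.finite_vertices.mem_toFinset.1 hv).1
    have h0 : 0 ≤ v j := hv'.1 j
    have h1 : v j ≤ 1 := hv'.2 j
    have hkv : (k : ℝ) * v j ≤ k := mul_le_of_le_one_right (by positivity) h1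
    rw [← Finset.card_filter]
    -- The inclusion in the unit cube enters here: `v j ≤ 1` ensures that the cutoff at `k` discards
    -- no index.
    have : (Finset.Ioc 0 k).filter (fun i : ℕ => (i : ℝ) ≤ k * v j)
        = Finset.Ioc 0 ⌊(k : ℝ) * v j⌋₊ := by
      ext i
      simp only [Finset.mem_filter, Finset.mem_Ioc, Nat.le_floor_iff (mul_nonneg k.cast_nonneg h0)]
      refine ⟨fun h => ⟨h.1.1, h.2⟩, fun h => ⟨⟨h.1, ?_⟩, h.2⟩⟩
      exact_mod_cast h.2.trans hkv
    rw [this, Nat.card_Ioc, Nat.sub_zero]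
  have hcent : P.centroid j = (V.card : ℝ)⁻¹ * ∑ v ∈ V, v j := by
    rw [HRep.centroid, hcard, finsum_mem_eq_finite_toFinset_sum _ P.finite_vertices]
    simp [hV]
  have hkR : (0 : ℝ) < k := by exact_mod_cast hk
  have hNR : (0 : ℝ) < V.card := by rw [← hcard]; exact_mod_cast hN
  have hdiff : ((∑ i ∈ Finset.Ioc 0 k, P.countGe k j i : ℕ) : ℝ) / ((k : ℝ) * P.vertices.ncard)
      - P.centroid j = (∑ v ∈ V, ((⌊(k : ℝ) * v j⌋₊ : ℝ) - k * v j)) / (k * V.card) := by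
    rw [hsum, hcent, hcard, Finset.sum_sub_distrib, ← Finset.mul_sum, Nat.cast_sum]
    field_simp
  rw [hdiff, abs_div, abs_of_pos (mul_pos hkR hNR), div_le_div_iff₀ (mul_pos hkR hNR) hkR]
  have hle : |∑ v ∈ V, ((⌊(k : ℝ) * v j⌋₊ : ℝ) - k * v j)| ≤ V.card := by
    refine (Finset.abs_sum_le_sum_abs _ _).trans ?_
    rw [Finset.card_eq_sum_ones, Nat.cast_sum]
    refine Finset.sum_le_sum fun v hv => ?_
    have h0 : 0 ≤ v j := (hP (P.finite_vertices.mem_toFinset.1 hv).1).1 j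
    have h1 := Nat.floor_le (mul_nonneg hkR.le h0)
    have h2 := Nat.lt_floor_add_one ((k : ℝ) * v j)
    rw [abs_le]
    constructor <;> push_cast <;> linarith
  nlinarith

/-! ### Reasoning about programs -/

theorem len_le_of_natAbs_lt {z : ℤ} {L : ℕ} (h : z.natAbs < 2 ^ L) : len z ≤ L + 1 :=
  Nat.succ_le_succ (Nat.size_le.2 h)

@[simp] theorem State.reg_setReg (s : State) (r x : ℕ) (z : ℤ) :
    (s.setReg r z).reg x = if x = r then z else s.reg x := by
  simp [State.setReg, Function.update_apply]

@[simp] theorem State.mem_setReg (s : State) (r : ℕ) (z : ℤ) : (s.setReg r z).mem = s.mem := rfl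

@[simp] theorem State.reg_setMem (s : State) (a : ℕ) (z : ℤ) : (s.setMem a z).reg = s.reg := rfl

theorem State.mem_setMem (s : State) (a n : ℕ) (z : ℤ) :
    (s.setMem a z).mem n = if n = a then z else s.mem n := by
  simp [State.setMem, Function.update_apply]

/-- The sequential composition of a list of programs. -/
def block : List Prog → Prog
  | [] => .skip
  | c :: cs => .seq c (block cs)

/-- An upper bound for the cost of one instruction that handles cells of `L` bits. -/
def unitCost (L : ℕ) : ℕ := 8 * (L + 1) ^ 2

/-- Started in `s`, the program `c` halts within `n` instructions, each of which costs at most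
`unitCost L`, and within `q` oracle calls, in a state that satisfies `Q`. -/
def Runs (O : HRep → ℕ) (L : ℕ) (c : Prog) (s : State) (n q : ℕ) (Q : State → Prop) : Prop :=
  ∃ s' t q', Exec O c s s' t q' ∧ t ≤ n * unitCost L ∧ q' ≤ q ∧ Q s'

namespace Runs

variable {O : HRep → ℕ} {L n q : ℕ} {s : State} {Q : State → Prop} {cs : List Prog}

theorem le_unitCost {a b : ℕ} (ha : a ≤ L + 1) (hb : b ≤ L + 1) : 1 + a + b ≤ unitCost L := by
  unfold unitCost
  nlinarith

theorem nil (h : Q s) : Runs O L (block []) s 1 0 Q :=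
  ⟨s, 1, 0, .skip s, by have := le_unitCost (L := L) (Nat.zero_le _) (Nat.zero_le _); omega,
    le_rfl, h⟩

theorem cons {c : Prog} {n₁ n₂ q₁ q₂ : ℕ} {R : State → Prop} (hc : Runs O L c s n₁ q₁ R)
    (hcs : ∀ s', R s' → Runs O L (block cs) s' n₂ q₂ Q) (hn : n₁ + n₂ ≤ n) (hq : q₁ + q₂ ≤ q) :
    Runs O L (block (c :: cs)) s n q Q := by
  obtain ⟨s₁, t₁, p₁, e₁, ht₁, hp₁, h₁⟩ := hc
  obtain ⟨s₂, t₂, p₂, e₂, ht₂, hp₂, h₂⟩ := hcs s₁ h₁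
  refine ⟨s₂, _, _, e₁.seq e₂, ?_, by omega, h₂⟩
  calc t₁ + t₂ ≤ (n₁ + n₂) * unitCost L := by rw [add_mul]; omega
    _ ≤ n * unitCost L := Nat.mul_le_mul_right _ hn

theorem step {c : Prog} {s₁ : State} {t p : ℕ} (he : Exec O c s s₁ t p) (ht : t ≤ unitCost L)
    (h : Runs O L (block cs) s₁ n q Q) : Runs O L (block (c :: cs)) s (n + 1) (q + p) Q :=
  cons (n₁ := 1) (q₁ := p) (R := fun s' => s' = s₁)
    ⟨s₁, t, p, he, by simpa using ht, le_rfl, rfl⟩ (by rintro _ rfl; exact h)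
    (by omega) (by omega)

theorem const {r : ℕ} {z : ℤ} (hz : z.natAbs < 2 ^ L)
    (h : Runs O L (block cs) (s.setReg r z) n q Q) :
    Runs O L (block (.const r z :: cs)) s (n + 1) q Q :=
  step (.const s r z) (le_unitCost (b := 0) (len_le_of_natAbs_lt hz) (Nat.zero_le _)) h

variable {r x y : ℕ} {a b v : ℤ}

/-- Here and in the next rules the operands and the result are parameters, so that the new register
content can be recorded in a convenient closed form. -/
theorem add (hx : s.reg x = a) (hy : s.reg y = b) (hv : a + b = v)
    (ha : a.natAbs < 2 ^ L) (hb : b.natAbs < 2 ^ L)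
    (h : Runs O L (block cs) (s.setReg r v) n q Q) :
    Runs O L (block (.add r x y :: cs)) s (n + 1) q Q := by
  subst hx hy hv
  exact step (.add s r x y) (le_unitCost (len_le_of_natAbs_lt ha) (len_le_of_natAbs_lt hb)) h

theorem sub (hx : s.reg x = a) (hy : s.reg y = b) (hv : a - b = v)
    (ha : a.natAbs < 2 ^ L) (hb : b.natAbs < 2 ^ L)
    (h : Runs O L (block cs) (s.setReg r v) n q Q) :
    Runs O L (block (.sub r x y :: cs)) s (n + 1) q Q := by
  subst hx hy hv
  exact step (.sub s r x y) (le_unitCost (len_le_of_natAbs_lt ha) (len_le_of_natAbs_lt hb)) h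

theorem mul (hx : s.reg x = a) (hy : s.reg y = b) (hv : a * b = v)
    (ha : a.natAbs < 2 ^ L) (hb : b.natAbs < 2 ^ L)
    (h : Runs O L (block cs) (s.setReg r v) n q Q) :
    Runs O L (block (.mul r x y :: cs)) s (n + 1) q Q := by
  subst hx hy hv
  exact step (.mul s r x y) (le_unitCost (len_le_of_natAbs_lt ha) (len_le_of_natAbs_lt hb)) h

theorem div (hx : s.reg x = a) (hy : s.reg y = b) (hv : a / b = v)
    (ha : a.natAbs < 2 ^ L) (hb : b.natAbs < 2 ^ L)
    (h : Runs O L (block cs) (s.setReg r v) n q Q) :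
    Runs O L (block (.div r x y :: cs)) s (n + 1) q Q := by
  subst hx hy hv
  exact step (.div s r x y) (le_unitCost (len_le_of_natAbs_lt ha) (len_le_of_natAbs_lt hb)) h

theorem store {p : ℕ} (hx : s.reg x = p) (hy : s.reg y = b)
    (ha : p < 2 ^ L) (hb : b.natAbs < 2 ^ L)
    (h : Runs O L (block cs) (s.setMem p b) n q Q) :
    Runs O L (block (.store x y :: cs)) s (n + 1) q Q := by
  subst hy
  have hp : (s.reg x).toNat = p := by rw [hx]; rfl
  have hx' : (s.reg x).natAbs < 2 ^ L := by rw [hx]; exact ha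
  refine step (.store s x y) (le_unitCost (len_le_of_natAbs_lt hx') (len_le_of_natAbs_lt hb)) ?_
  rw [hp]
  exact h

/-- A query hands over up to `L` cells of `L` bits each; this is why `unitCost` is quadratic in `L`.
-/
theorem query {rd rm ra d m w : ℕ} (hd : s.reg rd = d) (hm : s.reg rm = m) (ha : s.reg ra = 0)
    (hL : d + m + 2 * (m * (d + 1)) ≤ L)
    (hmem : ∀ i < 2 * (m * (d + 1)), (s.mem i).natAbs < 2 ^ L)
    (hw : O (s.readHRep d m 0) = w) (hwL : w < 2 ^ L)
    (h : Runs O L (block cs) (s.setReg r w) n q Q) :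
    Runs O L (block (.query r rd rm ra :: cs)) s (n + 1) (q + 1) Q := by
  have hd' : (s.reg rd).toNat = d := by rw [hd]; rfl
  have hm' : (s.reg rm).toNat = m := by rw [hm]; rfl
  have ha' : (s.reg ra).toNat = 0 := by rw [ha]; rfl
  have he := Exec.query (O := O) s r rd rm ra
  rw [hd', hm', ha', hw] at he
  refine step he ?_ h
  have hpow : L < 2 ^ L := Nat.lt_two_pow_self
  have h1 : len (s.reg rd) ≤ L + 1 := len_le_of_natAbs_lt (by rw [hd, Int.natAbs_natCast]; omega)
  have h2 : len (s.reg rm) ≤ L + 1 := len_le_of_natAbs_lt (by rw [hm, Int.natAbs_natCast]; omega)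
  have h3 : len (s.reg ra) = 1 := by rw [ha]; rfl
  have h4 : len (w : ℤ) ≤ L + 1 := len_le_of_natAbs_lt hwL
  have h5 : s.queryLen d m 0 ≤ d + m + 1 + 2 * (m * (d + 1)) * (L + 1) := by
    have : ∑ i ∈ Finset.range (2 * (m * (d + 1))), len (s.mem (0 + i))
        ≤ 2 * (m * (d + 1)) * (L + 1) := by
      refine (Finset.sum_le_card_nsmul _ _ (L + 1) fun i hi => ?_).trans (by simp)
      rw [zero_add]
      exact len_le_of_natAbs_lt (hmem i (Finset.mem_range.1 hi))
    exact Nat.add_le_add_left this _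
  have h6 : 2 * (m * (d + 1)) * (L + 1) ≤ L * (L + 1) := Nat.mul_le_mul_right _ (by omega)
  unfold unitCost
  nlinarith

/-- The invariant is indexed by the counter, that is, by the number of passes left. Each pass pays
one extra unit for its test, and the final failing test accounts for the `+ 1`. -/
theorem loop {c : Prog} (Inv : ℕ → State → Prop) {k : ℕ} (hk : k < 2 ^ L)
    (hreg : ∀ i s, Inv i s → s.reg x = i)
    (hbody : ∀ i < k, ∀ s, Inv (i + 1) s → Runs O L c s n q (Inv i)) (h : Inv k s) :
    Runs O L (.loop x c) s (k * (n + 1) + 1) (k * q) (Inv 0) := by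
  induction k generalizing s with
  | zero =>
    have hx := hreg 0 s h
    refine ⟨s, _, 0, .loopFalse (by simp [hx]), ?_, Nat.zero_le _, h⟩
    have := le_unitCost (L := L) (a := len (s.reg x)) (b := 0)
      (len_le_of_natAbs_lt (by simp [hx])) (Nat.zero_le _)
    omega
  | succ k ih =>
    have hx := hreg (k + 1) s h
    obtain ⟨s₁, t₁, p₁, e₁, ht₁, hp₁, h₁⟩ := hbody k k.lt_succ_self s h
    obtain ⟨s₂, t₂, p₂, e₂, ht₂, hp₂, h₂⟩ :=
      ih (by omega) (fun i hi => hbody i (by omega)) h₁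
    refine ⟨s₂, _, _, .loopTrue (by rw [hx]; positivity) e₁ e₂, ?_, ?_, h₂⟩
    · have := le_unitCost (L := L) (a := len (s.reg x)) (b := 0)
        (len_le_of_natAbs_lt (by rw [hx, Int.natAbs_natCast]; exact hk)) (Nat.zero_le _)
      calc 1 + len (s.reg x) + t₁ + t₂
          ≤ unitCost L + n * unitCost L + (k * (n + 1) + 1) * unitCost L := by omega
        _ = ((k + 1) * (n + 1) + 1) * unitCost L := by ring
    · calc p₁ + p₂ ≤ q + k * q := by omega
        _ = (k + 1) * q := by ring

end Runs

/-! ### The systems that are handed to the oracle -/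

/-- The number of memory cells that the input system occupies. -/
def HRep.cells (P : HRep) : ℕ := 2 * (P.numIneq * (P.dim + 1))

theorem natAbs_num_lt_of_lenRat_le {q : ℚ} {L : ℕ} (h : lenRat q ≤ L) : q.num.natAbs < 2 ^ L :=
  (Nat.lt_size_self _).trans_le (Nat.pow_le_pow_right two_pos (by
    simp only [lenRat, len] at h; omega))

theorem den_lt_of_lenRat_le {q : ℚ} {L : ℕ} (h : lenRat q ≤ L) : q.den < 2 ^ L :=
  (Nat.lt_size_self _).trans_le (Nat.pow_le_pow_right two_pos (by
    simp only [lenRat, len, Int.natAbs_natCast] at h; omega))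

/-- The `e`-th entry of the `i`-th row, where the right-hand side is the last entry. -/
def HRep.entry (P : HRep) (i : Fin P.numIneq) (e : Fin (P.dim + 1)) : ℚ :=
  Fin.snoc (α := fun _ => ℚ) (P.coeff i) (P.rhs i) e

theorem HRep.lenRat_entry_le (P : HRep) (i : Fin P.numIneq) (e : Fin (P.dim + 1)) :
    lenRat (P.entry i e) ≤ P.size := by
  have h1 : (∑ j, lenRat (P.coeff i j)) + lenRat (P.rhs i) ≤ P.size :=
    (Finset.single_le_sum (f := fun i => (∑ j, lenRat (P.coeff i j)) + lenRat (P.rhs i))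
      (fun _ _ => Nat.zero_le _) (Finset.mem_univ i)).trans (Nat.le_add_left _ _)
  induction e using Fin.lastCases with
  | last =>
    simp only [HRep.entry, Fin.snoc_last]
    omega
  | cast j =>
    have h2 : lenRat (P.coeff i j) ≤ ∑ j, lenRat (P.coeff i j) :=
      Finset.single_le_sum (f := fun j => lenRat (P.coeff i j))
        (fun _ _ => Nat.zero_le _) (Finset.mem_univ j)
    simp only [HRep.entry, Fin.snoc_castSucc]
    omega

theorem HRep.natAbs_toMem_lt (P : HRep) {L : ℕ} (hL : P.size ≤ L) (n : ℕ) :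
    (P.toMem n).natAbs < 2 ^ L := by
  unfold HRep.toMem
  split_ifs with h
  · exact natAbs_num_lt_of_lenRat_le ((P.lenRat_entry_le _ _).trans hL)
  · exact den_lt_of_lenRat_le ((P.lenRat_entry_le _ _).trans hL)
  · simp

theorem HRep.toMem_entry (P : HRep) (i : Fin P.numIneq) (e : Fin (P.dim + 1)) :
    P.toMem (2 * ((i : ℕ) * (P.dim + 1) + e)) = (P.entry i e).num ∧
      P.toMem (2 * ((i : ℕ) * (P.dim + 1) + e) + 1) = (P.entry i e).den := by
  have hlt : (i : ℕ) * (P.dim + 1) + e < P.numIneq * (P.dim + 1) := by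
    have := Nat.mul_le_mul_right (P.dim + 1) (Nat.succ_le_of_lt i.2)
    have := e.2
    rw [Nat.succ_mul] at *
    omega
  have hpair : finProdFinEquiv.symm (⟨(i : ℕ) * (P.dim + 1) + e, hlt⟩ :
      Fin (P.numIneq * (P.dim + 1))) = (i, e) := by
    rw [Equiv.symm_apply_eq]
    ext
    simp [finProdFinEquiv]
    ring
  have h0 : 2 * ((i : ℕ) * (P.dim + 1) + e) / 2 = (i : ℕ) * (P.dim + 1) + e := by omega
  have h1 : (2 * ((i : ℕ) * (P.dim + 1) + e) + 1) / 2 = (i : ℕ) * (P.dim + 1) + e := by omega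
  have h2 : 2 * ((i : ℕ) * (P.dim + 1) + e) % 2 = 0 := by omega
  have h3 : (2 * ((i : ℕ) * (P.dim + 1) + e) + 1) % 2 ≠ 0 := by omega
  constructor
  · simp only [HRep.toMem, h0, h2, hlt, hpair]
    rfl
  · simp only [HRep.toMem, h1, h3, hlt, hpair]
    rfl

/-- The memory starts with the input system. -/
def HoldsInput (P : HRep) (s : State) : Prop := ∀ n < P.cells, s.mem n = P.toMem n

/-- The memory holds the input system and two more rows with denominators `1`. -/
structure HoldsRows (P : HRep) (s : State) : Prop where
  input : HoldsInput P s
  den : ∀ e < 2 * (P.dim + 1), s.mem (P.cells + 2 * e + 1) = 1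

/-- The memory holds the input system, followed by the inequalities `k * x j ≤ i` and
`-k * x j ≤ -i`. -/
structure HoldsCut (P : HRep) (k j i : ℕ) (s : State) : Prop extends HoldsRows P s where
  num : ∀ e < 2 * (P.dim + 1), s.mem (P.cells + 2 * e) =
    if e = j then (k : ℤ) else if e = P.dim then (i : ℤ)
    else if e = P.dim + 1 + j then -(k : ℤ) else if e = P.dim + 1 + P.dim then -(i : ℤ) else 0

/-- The point `x` satisfies the inequality that is stored as row `i`. -/
def SatisfiesRow (s : State) (d i : ℕ) (x : Fin d → ℝ) : Prop :=
  ∑ j : Fin d, (s.readRat (2 * (i * (d + 1) + j)) : ℝ) * x j ≤ s.readRat (2 * (i * (d + 1) + d))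

theorem sum_ite_mul {d : ℕ} (j : Fin d) (c : ℚ) (x : Fin d → ℝ) :
    ∑ l, ((if l = j then c else 0 : ℚ) : ℝ) * x l = c * x j := by
  rw [Finset.sum_eq_single j (fun l _ hl => by simp [hl]) (by simp), if_pos rfl]

/-- The polyhedron that is described by the first `m` rows in the memory. -/
def State.polyhedron (s : State) (d m : ℕ) : Set (Fin d → ℝ) := (s.readHRep d m 0).toSet

theorem State.mem_polyhedron {s : State} {d m : ℕ} {x : Fin d → ℝ} :
    x ∈ s.polyhedron d m ↔ ∀ i : Fin m, SatisfiesRow s d i x := by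
  change (∀ i : Fin m, _) ↔ _
  simp only [State.readHRep, SatisfiesRow, zero_add]
  exact Iff.rfl

theorem State.finite_extremePoints_polyhedron (s : State) (d m : ℕ) :
    ((s.polyhedron d m).extremePoints ℝ).Finite := (s.readHRep d m 0).finite_vertices

theorem State.ncard_extremePoints_polyhedron_le (s : State) (d m : ℕ) :
    ((s.polyhedron d m).extremePoints ℝ).ncard ≤ 2 ^ m := (s.readHRep d m 0).ncard_vertices_le

theorem IsVertexCountOracle.eq_ncard {O : HRep → ℕ} (hO : IsVertexCountOracle O) {s : State}
    {d m : ℕ} (hs : Bornology.IsBounded (s.polyhedron d m)) :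
    O (s.readHRep d m 0) = ((s.polyhedron d m).extremePoints ℝ).ncard := hO _ hs

theorem HoldsInput.polyhedron_eq {P : HRep} {s : State} (h : HoldsInput P s) :
    s.polyhedron P.dim P.numIneq = P.toSet := by
  have key : ∀ (i : Fin P.numIneq) (e : Fin (P.dim + 1)),
      s.readRat (2 * ((i : ℕ) * (P.dim + 1) + e)) = P.entry i e := by
    intro i e
    have hlt : (i : ℕ) * (P.dim + 1) + e < P.numIneq * (P.dim + 1) := by
      have := Nat.mul_le_mul_right (P.dim + 1) (Nat.succ_le_of_lt i.2)
      have := e.2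
      rw [Nat.succ_mul] at *
      omega
    rw [State.readRat, h _ (by unfold HRep.cells; omega), h _ (by unfold HRep.cells; omega),
      (P.toMem_entry i e).1, (P.toMem_entry i e).2]
    exact_mod_cast Rat.num_div_den _
  ext x
  refine State.mem_polyhedron.trans (forall_congr' fun i => ?_)
  have h1 : ∀ j : Fin P.dim, s.readRat (2 * ((i : ℕ) * (P.dim + 1) + j)) = P.coeff i j := by
    intro j
    have := key i j.castSucc
    simpa [HRep.entry] using this
  have h2 : s.readRat (2 * ((i : ℕ) * (P.dim + 1) + P.dim)) = P.rhs i := by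
    have := key i (Fin.last _)
    simpa [HRep.entry] using this
  simp only [SatisfiesRow, h1, h2]

namespace HoldsCut

variable {P : HRep} {k i : ℕ} {j : Fin P.dim} {s : State}

theorem readRat (h : HoldsCut P k j i s) {e : ℕ} (he : e < 2 * (P.dim + 1)) :
    s.readRat (P.cells + 2 * e) = ((s.mem (P.cells + 2 * e) : ℤ) : ℚ) := by
  rw [State.readRat, h.den e he, Int.cast_one, div_one]

theorem satisfiesRow_le (h : HoldsCut P k j i s) (x : Fin P.dim → ℝ) :
    SatisfiesRow s P.dim P.numIneq x ↔ k * x j ≤ i := by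
  have hj := j.2
  have h1 : ∀ l : Fin P.dim, s.readRat (2 * (P.numIneq * (P.dim + 1) + l))
      = if l = j then (k : ℚ) else 0 := by
    intro l
    have hl := l.2
    have := h.readRat (e := l) (by omega)
    rw [h.num l (by omega)] at this
    rw [mul_add]
    refine this.trans ?_
    rcases eq_or_ne l j with rfl | hne
    · simp
    · have hne' : (l : ℕ) ≠ j := fun h => hne (Fin.ext h)
      rw [if_neg hne', if_neg hne, if_neg (by omega), if_neg (by omega), if_neg (by omega),
        Int.cast_zero]
  have h2 : s.readRat (2 * (P.numIneq * (P.dim + 1) + P.dim)) = (i : ℚ) := by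
    have := h.readRat (e := P.dim) (by omega)
    rw [h.num P.dim (by omega), if_neg (by omega), if_pos rfl] at this
    rw [mul_add]
    exact this.trans (Int.cast_natCast i)
  simp only [SatisfiesRow, h1, h2, sum_ite_mul, Rat.cast_natCast]

theorem satisfiesRow_ge (h : HoldsCut P k j i s) (x : Fin P.dim → ℝ) :
    SatisfiesRow s P.dim (P.numIneq + 1) x ↔ i ≤ k * x j := by
  have hj := j.2
  have haddr : ∀ e, 2 * ((P.numIneq + 1) * (P.dim + 1) + e) = P.cells + 2 * (P.dim + 1 + e) := by
    intro e
    unfold HRep.cells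
    ring
  have h1 : ∀ l : Fin P.dim, s.readRat (2 * ((P.numIneq + 1) * (P.dim + 1) + l))
      = if l = j then -(k : ℚ) else 0 := by
    intro l
    have hl := l.2
    rw [haddr, h.readRat (by omega), h.num _ (by omega)]
    rcases eq_or_ne l j with rfl | hne
    · rw [if_neg (by omega), if_neg (by omega), if_pos rfl, if_pos rfl]
      simp
    · have hne' : (l : ℕ) ≠ j := fun h => hne (Fin.ext h)
      rw [if_neg (by omega), if_neg (by omega), if_neg (by omega), if_neg (by omega), if_neg hne,
        Int.cast_zero]
  have h2 : s.readRat (2 * ((P.numIneq + 1) * (P.dim + 1) + P.dim)) = -(i : ℚ) := by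
    rw [haddr, h.readRat (by omega), h.num _ (by omega), if_neg (by omega), if_neg (by omega),
      if_neg (by omega), if_pos rfl]
    simp
  simp only [SatisfiesRow, h1, h2, sum_ite_mul, Rat.cast_neg, Rat.cast_natCast, neg_mul,
    neg_le_neg_iff]

/-- One memory layout serves both queries: `m + 1` rows describe the halfspace section, and one row
more describes the hyperplane section. -/
theorem polyhedron_succ (h : HoldsCut P k j i s) :
    s.polyhedron P.dim (P.numIneq + 1) = {x ∈ P.toSet | (k : ℝ) * x j ≤ i} := by
  ext x
  rw [State.mem_polyhedron, Fin.forall_fin_succ', ← h.input.polyhedron_eq]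
  exact and_congr State.mem_polyhedron.symm (h.satisfiesRow_le x)

theorem polyhedron_add_two (h : HoldsCut P k j i s) :
    s.polyhedron P.dim (P.numIneq + 2) = {x ∈ P.toSet | (k : ℝ) * x j = i} := by
  ext x
  rw [State.mem_polyhedron, Fin.forall_fin_succ', Fin.forall_fin_succ', ← h.input.polyhedron_eq]
  refine Iff.trans (and_congr (and_congr State.mem_polyhedron.symm (h.satisfiesRow_le x))
    (h.satisfiesRow_ge x)) ?_
  rw [and_assoc, ← le_antisymm_iff]
  rfl

/-- What the oracle answers to the two queries. -/
theorem exists_answers {O : HRep → ℕ} (hO : IsVertexCountOracle O) (hP : P.IsPolytope)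
    (h : HoldsCut P k j i s) :
    ∃ a b : ℕ, O (s.readHRep P.dim (P.numIneq + 1) 0) = a ∧
      O (s.readHRep P.dim (P.numIneq + 2) 0) = b ∧
      a ≤ 2 ^ (P.numIneq + 1) ∧ b ≤ 2 ^ (P.numIneq + 2) ∧
      P.countGe k j i + a = P.vertices.ncard + b := by
  refine ⟨_, _, hO.eq_ncard ?_, hO.eq_ncard ?_, s.ncard_extremePoints_polyhedron_le _ _,
    s.ncard_extremePoints_polyhedron_le _ _, ?_⟩
  · rw [h.polyhedron_succ]
    exact Bornology.IsBounded.subset hP fun _ hx => hx.1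
  · rw [h.polyhedron_add_two]
    exact Bornology.IsBounded.subset hP fun _ hx => hx.1
  · have hfin := s.finite_extremePoints_polyhedron P.dim (P.numIneq + 1)
    rw [h.polyhedron_succ] at hfin
    rw [h.polyhedron_succ, h.polyhedron_add_two]
    exact ncard_extremePoints_add ((k : ℝ) • LinearMap.proj (R := ℝ) (φ := fun _ => ℝ) j)
      (i : ℝ) P.convex_toSet P.finite_vertices hfin

theorem natAbs_mem_lt (h : HoldsCut P k j i s) {L : ℕ} (hL : P.size ≤ L) (hk : k < 2 ^ L)
    (hi : i < 2 ^ L) (hL0 : 0 < L) {n : ℕ} (hn : n < 2 * ((P.numIneq + 2) * (P.dim + 1))) :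
    (s.mem n).natAbs < 2 ^ L := by
  have h1 : 1 < 2 ^ L := Nat.one_lt_two_pow hL0.ne'
  have hcells : 2 * ((P.numIneq + 2) * (P.dim + 1)) = P.cells + 4 * (P.dim + 1) := by
    unfold HRep.cells
    ring
  rcases lt_or_ge n P.cells with hlt | hge
  · rw [h.input n hlt]
    exact P.natAbs_toMem_lt hL n
  · obtain ⟨e, rfl⟩ := Nat.exists_eq_add_of_le hge
    obtain ⟨e', rfl | rfl⟩ := e.even_or_odd'
    · rw [h.num e' (by omega)]
      split_ifs <;> omega
    · rw [← add_assoc, h.den e' (by omega)]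
      exact h1

end HoldsCut

/-! ### The program -/

/-- Writes a denominator `1`. -/
def denStep : List Prog := [.store 21 4, .add 21 21 15, .sub 20 20 4]

/-- For the current coordinate `j` and the current `i`, adds the number of vertices `v` with
`i ≤ k * v j` to register `18`. -/
def countStep : List Prog :=
  [.store 13 19, .sub 23 8 19, .store 14 23, .query 24 0 10 8, .sub 18 18 24, .query 24 0 11 8,
    .add 18 18 24, .add 18 18 9, .sub 19 19 4]

/-- Computes and writes one coordinate of the output. -/
def coordStep : List Prog :=
  [.sub 17 17 15, .add 22 17 6, .store 17 5, .sub 23 8 5, .store 22 23, .const 18 0, .add 19 5 8,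
    .loop 19 (block countStep), .store 17 8, .store 22 8, .add 22 22 6, .store 22 18,
    .add 22 22 4, .store 22 12, .sub 16 16 4]

/-- Approximates the vertex centroid. -/
def centroidProg : List Prog :=
  [.const 4 1, .const 15 2, .const 8 0, .div 5 3 2, .add 5 5 4, .add 6 0 4, .mul 7 1 6,
    .mul 7 7 15, .mul 6 6 15, .query 9 0 1 8, .add 10 1 4, .add 11 10 4, .mul 12 5 9,
    .add 13 7 6, .sub 13 13 15, .add 14 13 6, .add 21 7 4, .add 20 6 8,
    .loop 20 (block denStep), .add 17 13 8, .add 16 0 8, .loop 16 (block coordStep),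
    .add 0 7 6, .add 0 0 6]

/-- `L` bits suffice for all of the numbers that occur. -/
structure Fits (P : HRep) (k L : ℕ) : Prop where
  pos : 0 < k
  size : P.size ≤ L
  addr : P.dim + P.numIneq + P.cells + 6 * (P.dim + 1) ≤ L
  value : P.numIneq + k + 3 ≤ L

/-- The left side covers a running sum of at most `k * N`, the two answers of at most `2 * 2 ^ m`
and `4 * 2 ^ m`, and `N ≤ 2 ^ m`. Spending `k` bits on the factor `k` is wasteful but harmless, as
`k` is of order `1 / ε`. -/
theorem Fits.lt_two_pow {P : HRep} {k L : ℕ} (h : Fits P k L) :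
    7 * 2 ^ P.numIneq + k * 2 ^ P.numIneq < 2 ^ L := by
  have h1 : k < 2 ^ k := Nat.lt_two_pow_self
  have h2 : 2 ^ (P.numIneq + k + 3) ≤ 2 ^ L := Nat.pow_le_pow_right two_pos h.value
  rw [pow_add, pow_add] at h2
  have h3 : 0 < 2 ^ P.numIneq := by positivity
  have h4 := h.pos
  nlinarith

/-- The registers that keep their values after the preparations. -/
structure FixedRegs (P : HRep) (k : ℕ) (s : State) : Prop where
  r0 : s.reg 0 = (P.dim : ℕ)
  r4 : s.reg 4 = 1
  r5 : s.reg 5 = k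
  r6 : s.reg 6 = (2 * (P.dim + 1) : ℕ)
  r7 : s.reg 7 = P.cells
  r8 : s.reg 8 = 0
  r9 : s.reg 9 = P.vertices.ncard
  r10 : s.reg 10 = (P.numIneq + 1 : ℕ)
  r11 : s.reg 11 = (P.numIneq + 2 : ℕ)
  r12 : s.reg 12 = (k * P.vertices.ncard : ℕ)
  r13 : s.reg 13 = (P.cells + 2 * P.dim : ℕ)
  r14 : s.reg 14 = (P.cells + 2 * (P.dim + 1 + P.dim) : ℕ)
  r15 : s.reg 15 = 2

theorem FixedRegs.congr {P : HRep} {k : ℕ} {s s' : State} (h : FixedRegs P k s)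
    (hs : ∀ r < 16, s'.reg r = s.reg r) : FixedRegs P k s' where
  r0 := (hs _ (by norm_num)).trans h.r0
  r4 := (hs _ (by norm_num)).trans h.r4
  r5 := (hs _ (by norm_num)).trans h.r5
  r6 := (hs _ (by norm_num)).trans h.r6
  r7 := (hs _ (by norm_num)).trans h.r7
  r8 := (hs _ (by norm_num)).trans h.r8
  r9 := (hs _ (by norm_num)).trans h.r9
  r10 := (hs _ (by norm_num)).trans h.r10
  r11 := (hs _ (by norm_num)).trans h.r11
  r12 := (hs _ (by norm_num)).trans h.r12
  r13 := (hs _ (by norm_num)).trans h.r13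
  r14 := (hs _ (by norm_num)).trans h.r14
  r15 := (hs _ (by norm_num)).trans h.r15

theorem FixedRegs.setMem {P : HRep} {k : ℕ} {s : State} (h : FixedRegs P k s) (a : ℕ) (z : ℤ) :
    FixedRegs P k (s.setMem a z) := h.congr fun _ _ => rfl

theorem FixedRegs.setReg {P : HRep} {k : ℕ} {s : State} (h : FixedRegs P k s) {r : ℕ}
    (hr : 16 ≤ r) (z : ℤ) : FixedRegs P k (s.setReg r z) :=
  h.congr fun x hx => by rw [State.reg_setReg, if_neg (by omega)]

/-- The sum of the numbers of vertices `v` with `l ≤ k * v j` over `i < l ≤ k`. -/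
noncomputable def HRep.partialCount (P : HRep) (k : ℕ) (j : Fin P.dim) (i : ℕ) : ℕ :=
  ∑ l ∈ Finset.Ioc i k, P.countGe k j l

theorem HRep.partialCount_of_lt (P : HRep) {k : ℕ} (j : Fin P.dim) {i : ℕ} (hi : i < k) :
    P.partialCount k j i = P.countGe k j (i + 1) + P.partialCount k j (i + 1) := by
  unfold HRep.partialCount
  rw [← Finset.sum_Ioc_consecutive _ (Nat.le_succ i) hi, Nat.Ioc_succ_singleton,
    Finset.sum_singleton]

theorem HRep.partialCount_le (P : HRep) (k : ℕ) (j : Fin P.dim) (i : ℕ) :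
    P.partialCount k j i ≤ k * P.vertices.ncard := by
  refine (Finset.sum_le_card_nsmul _ _ _ fun l _ => P.countGe_le k j l).trans ?_
  rw [Nat.card_Ioc, smul_eq_mul]
  exact Nat.mul_le_mul_right _ (Nat.sub_le _ _)

/-- The coordinates from `J` on have been written. -/
def HoldsOutput (P : HRep) (k J : ℕ) (s : State) : Prop :=
  ∀ j : Fin P.dim, J ≤ j →
    s.mem (P.cells + 4 * (P.dim + 1) + 2 * j) = P.partialCount k j 0 ∧
    s.mem (P.cells + 4 * (P.dim + 1) + 2 * j + 1) = (k * P.vertices.ncard : ℕ)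

/-- The invariant of the loop that writes denominators. -/
structure DenInv (P : HRep) (k c : ℕ) (s : State) : Prop extends FixedRegs P k s where
  input : HoldsInput P s
  le : c ≤ 2 * (P.dim + 1)
  r20 : s.reg 20 = c
  r21 : s.reg 21 = (P.cells + 1 + 2 * (2 * (P.dim + 1) - c) : ℕ)
  den : ∀ e < 2 * (P.dim + 1) - c, s.mem (P.cells + 2 * e + 1) = 1
  num : ∀ e < 2 * (P.dim + 1), s.mem (P.cells + 2 * e) = 0

/-- The invariant of the loop over `i`. -/
structure CountInv (P : HRep) (k : ℕ) (j : Fin P.dim) (i : ℕ) (s : State) : Prop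
    extends FixedRegs P k s where
  rows : HoldsRows P s
  le : i ≤ k
  r16 : s.reg 16 = (j + 1 : ℕ)
  r17 : s.reg 17 = (P.cells + 2 * j : ℕ)
  r18 : s.reg 18 = P.partialCount k j i
  r19 : s.reg 19 = i
  r22 : s.reg 22 = (P.cells + 2 * (P.dim + 1 + j) : ℕ)
  num : ∀ e < 2 * (P.dim + 1), e ≠ P.dim → e ≠ P.dim + 1 + P.dim →
    s.mem (P.cells + 2 * e) =
      if e = j then (k : ℤ) else if e = P.dim + 1 + j then -(k : ℤ) else 0
  out : HoldsOutput P k (j + 1) s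

/-- The invariant of the loop over the coordinates. -/
structure CoordInv (P : HRep) (k J : ℕ) (s : State) : Prop extends FixedRegs P k s where
  rows : HoldsRows P s
  le : J ≤ P.dim
  r16 : s.reg 16 = J
  r17 : s.reg 17 = (P.cells + 2 * J : ℕ)
  num : ∀ e < 2 * (P.dim + 1), e ≠ P.dim → e ≠ P.dim + 1 + P.dim → s.mem (P.cells + 2 * e) = 0
  out : HoldsOutput P k J s

/-! ### Correctness and cost of the loops and of the whole program -/

variable {O : HRep → ℕ} {P : HRep} {k L : ℕ} {s : State}

theorem runs_denStep (hL : Fits P k L) {c : ℕ} (h : DenInv P k (c + 1) s) :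
    Runs O L (block denStep) s 4 0 (DenInv P k c) := by
  have hpow : L < 2 ^ L := Nat.lt_two_pow_self
  have haddr := hL.addr
  have hle := h.le
  refine Runs.store h.r21 h.r4 (by omega) (by omega) ?_
  refine Runs.add h.r21 h.r15
    (v := (P.cells + 1 + 2 * (2 * (P.dim + 1) - c) : ℕ)) (by omega) (by omega) (by omega) ?_
  refine Runs.sub (a := (c + 1 : ℕ)) (b := 1) (v := c) (by simp [h.r20]) (by simp [h.r4])
    (by omega) (by omega) (by omega) ?_
  refine Runs.nil ⟨?_, ?_, by omega, by simp, by simp, ?_, ?_⟩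
  · exact ((h.toFixedRegs.setMem _ _).setReg (by norm_num) _).setReg (by norm_num) _
  · intro n hn
    simp only [State.mem_setReg, State.mem_setMem]
    rw [if_neg (by omega), h.input n hn]
  · intro e he
    simp only [State.mem_setReg, State.mem_setMem]
    split_ifs with h1
    · rfl
    · exact h.den e (by omega)
  · intro e he
    simp only [State.mem_setReg, State.mem_setMem]
    rw [if_neg (by omega), h.num e he]

theorem runs_countStep (hO : IsVertexCountOracle O) (hP : P.IsPolytope) (hL : Fits P k L)
    {j : Fin P.dim} {i : ℕ} (h : CountInv P k j (i + 1) s) :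
    Runs O L (block countStep) s 10 2 (CountInv P k j i) := by
  have hpow : L < 2 ^ L := Nat.lt_two_pow_self
  have haddr := hL.addr
  have hval := hL.value
  have hle := h.le
  have hj := j.2
  have hlt := hL.lt_two_pow
  have hN : P.vertices.ncard ≤ 2 ^ P.numIneq := P.ncard_vertices_le
  have hkN : k * P.vertices.ncard ≤ k * 2 ^ P.numIneq := Nat.mul_le_mul_left _ hN
  have hS := P.partialCount_le k j (i + 1)
  have hcells : 2 * ((P.numIneq + 2) * (P.dim + 1)) = P.cells + 4 * (P.dim + 1) := by
    unfold HRep.cells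
    ring
  have hcells' : 2 * ((P.numIneq + 1) * (P.dim + 1)) = P.cells + 2 * (P.dim + 1) := by
    unfold HRep.cells
    ring
  refine Runs.store h.r13 h.r19 (by omega) (by omega) ?_
  refine Runs.sub (a := 0) (b := (i + 1 : ℕ)) (v := -(i + 1 : ℕ)) (by simp [h.r8])
    (by simp [h.r19]) (by omega) (by omega) (by omega) ?_
  refine Runs.store (p := P.cells + 2 * (P.dim + 1 + P.dim)) (b := -(i + 1 : ℕ))
    (by simp [h.r14]) (by simp) (by omega) (by omega) ?_
  generalize hs₁ : State.setMem _ (P.cells + 2 * (P.dim + 1 + P.dim)) _ = s₁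
  have hreg : ∀ r, r ≠ 23 → s₁.reg r = s.reg r := by
    intro r hr
    subst hs₁
    simp [hr]
  have hmem : ∀ n, s₁.mem n = if n = P.cells + 2 * (P.dim + 1 + P.dim) then -((i + 1 : ℕ) : ℤ)
      else if n = P.cells + 2 * P.dim then ((i + 1 : ℕ) : ℤ) else s.mem n := by
    intro n
    subst hs₁
    simp only [State.mem_setReg, State.mem_setMem]
  have hfix : FixedRegs P k s₁ := h.toFixedRegs.congr fun r hr => hreg r (by omega)
  have hcut : HoldsCut P k j (i + 1) s₁ := by
    refine ⟨⟨fun n hn => ?_, fun e he => ?_⟩, fun e he => ?_⟩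
    · rw [hmem, if_neg (by omega), if_neg (by omega), h.rows.input n hn]
    · rw [hmem, if_neg (by omega), if_neg (by omega), h.rows.den e he]
    -- The invariant is silent about the two right-hand sides, which may hold leftovers from an
    -- earlier pass; both have just been overwritten.
    · rw [hmem]
      by_cases h1 : e = P.dim
      · subst h1
        rw [if_neg (by omega), if_pos rfl, if_neg (by omega), if_pos rfl]
      by_cases h2 : e = P.dim + 1 + P.dim
      · subst h2
        rw [if_pos rfl, if_neg (by omega), if_neg (by omega), if_neg (by omega), if_pos rfl]
      rw [if_neg (by omega), if_neg (by omega), h.num e he h1 h2, if_neg h1, if_neg h2]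
  obtain ⟨a, b, ha, hb, haL, hbL, hab⟩ := hcut.exists_answers hO hP
  rw [pow_succ] at haL
  rw [pow_add] at hbL
  have hbound : ∀ n < 2 * ((P.numIneq + 2) * (P.dim + 1)), (s₁.mem n).natAbs < 2 ^ L :=
    fun n hn => hcut.natAbs_mem_lt hL.size (by omega) (by omega) (by omega) hn
  -- The pass that starts with counter `i + 1` treats level `i + 1`, so the levels used are `k, ...,
  -- 1` and never `0`.
  have hcount := P.partialCount_of_lt (k := k) j (i := i) (by omega)
  refine Runs.query (w := a) hfix.r0 hfix.r10 hfix.r8 (by omega)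
    (fun n hn => hbound n (by omega)) ha (by omega) ?_
  -- The new count is `N + b - a`. Subtracting `a` first may produce a negative intermediate value,
  -- which integer registers allow.
  refine Runs.sub (a := P.partialCount k j (i + 1)) (b := a) (by simp [hreg, h.r18]) (by simp) rfl
    (by omega) (by omega) ?_
  refine Runs.query (d := P.dim) (m := P.numIneq + 2) (w := b) (by simp [hfix.r0])
    (by simp [hfix.r11]) (by simp [hfix.r8]) (by omega) hbound hb (by omega) ?_
  refine Runs.add (a := P.partialCount k j (i + 1) - a) (b := b) (by simp) (by simp) rfl
    (by omega) (by omega) ?_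
  refine Runs.add (a := P.partialCount k j (i + 1) - a + b) (b := P.vertices.ncard)
    (v := P.partialCount k j i) (by simp) (by simp [hfix.r9]) (by omega) (by omega) (by omega) ?_
  refine Runs.sub (a := (i + 1 : ℕ)) (b := 1) (v := i) (by simp [hreg, h.r19])
    (by simp [hfix.r4]) (by omega) (by omega) (by omega) ?_
  refine Runs.nil ⟨?_, ⟨hcut.input, hcut.den⟩, by omega, by simp [hreg, h.r16],
    by simp [hreg, h.r17], by simp, by simp, by simp [hreg, h.r22], ?_, ?_⟩
  · exact hfix.congr fun r hr => by
      simp [show r ≠ 19 by omega, show r ≠ 18 by omega, show r ≠ 24 by omega]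
  · intro e he h1 h2
    simp only [State.mem_setReg]
    rw [hmem, if_neg (by omega), if_neg (by omega), h.num e he h1 h2]
  · intro l hl
    have hl' := l.2
    simp only [State.mem_setReg]
    rw [hmem, hmem, if_neg (by omega), if_neg (by omega), if_neg (by omega), if_neg (by omega)]
    exact h.out l hl

/-- The entries `k` and `-k` are written in column `j` before the inner loop and reset to `0` after
it, so every coordinate starts from blank rows. The loop takes `11 * k + 1` units and the rest `15`.
-/
theorem runs_coordStep (hO : IsVertexCountOracle O) (hP : P.IsPolytope) (hL : Fits P k L)
    (j : Fin P.dim) (h : CoordInv P k (j + 1) s) :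
    Runs O L (block coordStep) s (11 * k + 16) (2 * k) (CoordInv P k j) := by
  have hpow : L < 2 ^ L := Nat.lt_two_pow_self
  have haddr := hL.addr
  have hval := hL.value
  have hj := j.2
  have hlt := hL.lt_two_pow
  have hN : P.vertices.ncard ≤ 2 ^ P.numIneq := P.ncard_vertices_le
  have hkN : k * P.vertices.ncard ≤ k * 2 ^ P.numIneq := Nat.mul_le_mul_left _ hN
  refine Runs.sub (b := 2) (v := (P.cells + 2 * j : ℕ)) h.r17 h.r15
    (by omega) (by omega) (by omega) ?_
  refine Runs.add (a := (P.cells + 2 * j : ℕ)) (b := (2 * (P.dim + 1) : ℕ))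
    (v := (P.cells + 2 * (P.dim + 1 + j) : ℕ)) (by simp) (by simp [h.r6])
    (by omega) (by omega) (by omega) ?_
  refine Runs.store (p := P.cells + 2 * j) (b := k) (by simp) (by simp [h.r5])
    (by omega) (by omega) ?_
  refine Runs.sub (a := 0) (b := k) (v := -k) (by simp [h.r8]) (by simp [h.r5])
    (by omega) (by omega) (by omega) ?_
  refine Runs.store (p := P.cells + 2 * (P.dim + 1 + j)) (b := -k) (by simp) (by simp)
    (by omega) (by omega) ?_
  refine Runs.const (z := 0) (by simp) ?_
  refine Runs.add (a := k) (b := 0) (v := k) (by simp [h.r5]) (by simp [h.r8])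
    (by omega) (by omega) (by simp) ?_
  refine Runs.cons (n₂ := 8) (q₂ := 0) (Runs.loop (CountInv P k j) (k := k) (by omega)
    (fun i s h => h.r19) (fun i _ s h => runs_countStep hO hP hL h) ?_) ?_ (by omega) (by omega)
  · refine ⟨?_, ⟨?_, ?_⟩, le_rfl, by simp [h.r16], by simp, by simp [HRep.partialCount], by simp,
      by simp, ?_, ?_⟩
    · exact h.toFixedRegs.congr fun r hr => by
        simp [show r ≠ 19 by omega, show r ≠ 18 by omega, show r ≠ 23 by omega,
          show r ≠ 22 by omega, show r ≠ 17 by omega]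
    · intro n hn
      simp only [State.mem_setReg, State.mem_setMem]
      rw [if_neg (by omega), if_neg (by omega), h.rows.input n hn]
    · intro e he
      simp only [State.mem_setReg, State.mem_setMem]
      rw [if_neg (by omega), if_neg (by omega), h.rows.den e he]
    · intro e he h1 h2
      simp only [State.mem_setReg, State.mem_setMem]
      rw [h.num e he h1 h2]
      split_ifs <;> first | rfl | omega
    · intro l hl
      have hl' := l.2
      simp only [State.mem_setReg, State.mem_setMem]
      rw [if_neg (by omega), if_neg (by omega), if_neg (by omega), if_neg (by omega)]
      exact h.out l hl
  · clear! s
    intro s h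
    have hS := P.partialCount_le k j 0
    refine Runs.store h.r17 h.r8 (by omega) (by simp) ?_
    refine Runs.store (p := P.cells + 2 * (P.dim + 1 + j)) (b := 0) h.r22 (by simp [h.r8])
      (by omega) (by simp) ?_
    refine Runs.add (v := (P.cells + 4 * (P.dim + 1) + 2 * j : ℕ)) h.r22 h.r6
      (by omega) (by omega) (by omega) ?_
    refine Runs.store (p := P.cells + 4 * (P.dim + 1) + 2 * j) (b := P.partialCount k j 0)
      (by simp) (by simp [h.r18]) (by omega) (by omega) ?_
    refine Runs.add (a := (P.cells + 4 * (P.dim + 1) + 2 * j : ℕ)) (b := 1)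
      (v := (P.cells + 4 * (P.dim + 1) + 2 * j + 1 : ℕ)) (by simp) (by simp [h.r4])
      (by omega) (by omega) (by omega) ?_
    refine Runs.store (p := P.cells + 4 * (P.dim + 1) + 2 * j + 1)
      (b := (k * P.vertices.ncard : ℕ)) (by simp) (by simp [h.r12]) (by omega) (by omega) ?_
    refine Runs.sub (a := (j + 1 : ℕ)) (b := 1) (v := (j : ℕ)) (by simp [h.r16]) (by simp [h.r4])
      (by omega) (by omega) (by omega) ?_
    refine Runs.nil ⟨?_, ⟨?_, ?_⟩, by omega, by simp, by simp [h.r17], ?_, ?_⟩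
    · exact h.toFixedRegs.congr fun r hr => by
        simp [show r ≠ 16 by omega, show r ≠ 22 by omega]
    · intro n hn
      simp only [State.mem_setReg, State.mem_setMem]
      rw [if_neg (by omega), if_neg (by omega), if_neg (by omega), if_neg (by omega),
        h.rows.input n hn]
    · intro e he
      simp only [State.mem_setReg, State.mem_setMem]
      rw [if_neg (by omega), if_neg (by omega), if_neg (by omega), if_neg (by omega),
        h.rows.den e he]
    · intro e he h1 h2
      simp only [State.mem_setReg, State.mem_setMem]
      rw [h.num e he h1 h2, if_neg (by omega), if_neg (by omega)]
      split_ifs <;> first | rfl | omega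
    · intro l hl
      have hl' := l.2
      simp only [State.mem_setReg, State.mem_setMem]
      by_cases h1 : j = l
      · subst h1
        rw [if_neg (by omega), if_pos rfl, if_pos rfl]
        exact ⟨rfl, rfl⟩
      · have h2 : (j : ℕ) ≠ l := fun h => h1 (Fin.ext h)
        have h3 := h.out l (by omega)
        rw [if_neg (by omega), if_neg (by omega), if_neg (by omega), if_neg (by omega),
          if_neg (by omega), if_neg (by omega), if_neg (by omega), if_neg (by omega)]
        exact h3

theorem runs_centroidProg (hO : IsVertexCountOracle O) (hP : P.IsPolytope) (hL : Fits P k L)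
    {ε : ℚ} (hεL : lenRat ε ≤ L) (hk : (k : ℤ) = ε.den / ε.num + 1) :
    Runs O L (block centroidProg) (initState P ε)
      (10 * (P.dim + 1) + P.dim * (11 * k + 17) + 25) (P.dim * (2 * k) + 1)
      (fun s => s.reg 0 = (P.cells + 4 * (P.dim + 1) : ℕ) ∧ HoldsOutput P k 0 s) := by
  have hpow : L < 2 ^ L := Nat.lt_two_pow_self
  have haddr := hL.addr
  have hval := hL.value
  have hcells : P.cells = 2 * (P.numIneq * (P.dim + 1)) := rfl
  have hlt := hL.lt_two_pow
  have hN : P.vertices.ncard ≤ 2 ^ P.numIneq := P.ncard_vertices_le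
  have hkN : k * P.vertices.ncard ≤ k * 2 ^ P.numIneq := Nat.mul_le_mul_left _ hN
  refine Runs.const (by omega) ?_
  refine Runs.const (by omega) ?_
  refine Runs.const (by simp) ?_
  -- Integer division rounds down, so the quotient is `⌊1/ε⌋`.
  refine Runs.div (a := ε.den) (b := ε.num) (v := k - 1) (by simp [initState])
    (by simp [initState]) (by omega) (by simpa using den_lt_of_lenRat_le hεL) (natAbs_num_lt_of_lenRat_le hεL) ?_
  refine Runs.add (a := k - 1) (b := 1) (v := k) (by simp) (by simp) (by omega) (by omega)
    (by omega) ?_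
  refine Runs.add (a := P.dim) (b := 1) (v := (P.dim + 1 : ℕ)) (by simp [initState]) (by simp)
    (by omega) (by omega) (by omega) ?_
  refine Runs.mul (a := P.numIneq) (b := (P.dim + 1 : ℕ)) (v := (P.numIneq * (P.dim + 1) : ℕ))
    (by simp [initState]) (by simp) (by push_cast; rfl) (by omega) (by omega) ?_
  refine Runs.mul (a := (P.numIneq * (P.dim + 1) : ℕ)) (b := 2) (v := P.cells) (by simp) (by simp)
    (by omega) (by omega) (by omega) ?_
  refine Runs.mul (a := (P.dim + 1 : ℕ)) (b := 2) (v := (2 * (P.dim + 1) : ℕ)) (by simp) (by simp)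
    (by omega) (by omega) (by omega) ?_
  refine Runs.query (d := P.dim) (m := P.numIneq) (w := P.vertices.ncard) (q := P.dim * (2 * k))
    (by simp [initState]) (by simp [initState]) (by simp) (by omega)
    (fun n _ => P.natAbs_toMem_lt hL.size n) ?_ (by omega) ?_
  · have hin : HoldsInput P (initState P ε) := fun n _ => rfl
    have := hO.eq_ncard (s := initState P ε) (d := P.dim) (m := P.numIneq)
      (by rw [hin.polyhedron_eq]; exact hP)
    rw [hin.polyhedron_eq] at this
    exact this
  refine Runs.add (a := P.numIneq) (b := 1) (v := (P.numIneq + 1 : ℕ)) (by simp [initState])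
    (by simp) (by omega) (by omega) (by omega) ?_
  refine Runs.add (a := (P.numIneq + 1 : ℕ)) (b := 1) (v := (P.numIneq + 2 : ℕ)) (by simp)
    (by simp) (by omega) (by omega) (by omega) ?_
  refine Runs.mul (a := k) (b := P.vertices.ncard) (v := (k * P.vertices.ncard : ℕ)) (by simp)
    (by simp) (by push_cast; rfl) (by omega) (by omega) ?_
  refine Runs.add (a := P.cells) (b := (2 * (P.dim + 1) : ℕ))
    (v := (P.cells + 2 * (P.dim + 1) : ℕ)) (by simp) (by simp) (by omega) (by omega) (by omega) ?_
  refine Runs.sub (a := (P.cells + 2 * (P.dim + 1) : ℕ)) (b := 2)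
    (v := (P.cells + 2 * P.dim : ℕ)) (by simp) (by simp) (by omega) (by omega) (by omega) ?_
  refine Runs.add (a := (P.cells + 2 * P.dim : ℕ)) (b := (2 * (P.dim + 1) : ℕ))
    (v := (P.cells + 2 * (P.dim + 1 + P.dim) : ℕ)) (by simp) (by simp)
    (by omega) (by omega) (by omega) ?_
  refine Runs.add (a := P.cells) (b := 1) (v := (P.cells + 1 : ℕ)) (by simp) (by simp)
    (by omega) (by omega) (by omega) ?_
  refine Runs.add (a := (2 * (P.dim + 1) : ℕ)) (b := 0) (v := (2 * (P.dim + 1) : ℕ)) (by simp)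
    (by simp) (by omega) (by omega) (by omega) ?_
  refine Runs.cons (n₂ := P.dim * (11 * k + 17) + 6) (q₂ := P.dim * (2 * k))
    (Runs.loop (DenInv P k) (by omega) (fun c s h => h.r20)
      (fun c _ s h => runs_denStep hL h) (k := 2 * (P.dim + 1)) ?_) ?_ (by omega) (by omega)
  · refine ⟨?_, fun n _ => rfl, le_rfl, by simp, by simp, fun e he => by omega, fun e he => ?_⟩
    · constructor <;> simp [initState]
    · simp only [State.mem_setReg, initState, HRep.toMem]
      rw [dif_neg (by omega)]
  clear hk hεL
  intro s h
  refine Runs.add (v := (P.cells + 2 * P.dim : ℕ)) h.r13 h.r8 (by omega) (by omega) (by omega) ?_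
  refine Runs.add (a := P.dim) (b := 0) (v := P.dim) (by simp [h.r0]) (by simp [h.r8])
    (by omega) (by omega) (by omega) ?_
  refine Runs.cons (n₂ := 3) (q₂ := 0) (Runs.loop (CoordInv P k) (by omega)
    (fun j s h => h.r16) (fun j hj s h => runs_coordStep hO hP hL ⟨j, hj⟩ h) (k := P.dim) ?_) ?_
    (by rw [add_assoc (11 * k)]) (by omega)
  · refine ⟨?_, ⟨h.input, fun e he => h.den e he⟩, le_rfl, by simp, by simp,
      fun e he _ _ => h.num e he, fun j hj => absurd j.2 (by omega)⟩
    exact (h.toFixedRegs.setReg (by norm_num) _).setReg (by norm_num) _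
  intro s h
  refine Runs.add (v := (P.cells + 2 * (P.dim + 1) : ℕ)) h.r7 h.r6
    (by omega) (by omega) (by omega) ?_
  refine Runs.add (a := (P.cells + 2 * (P.dim + 1) : ℕ)) (b := (2 * (P.dim + 1) : ℕ))
    (v := (P.cells + 4 * (P.dim + 1) : ℕ)) (by simp) (by simp [h.r6])
    (by omega) (by omega) (by omega) ?_
  exact Runs.nil ⟨by simp, h.out⟩

/-! ### Polynomial bounds and the conclusion -/

/-- A quadratic `L` is needed because `L` also bounds the number of cells in a query, about `2 * m *
(d + 1)`. -/
theorem fits_of_size_le {P : HRep} {k X : ℕ} (hk : 0 < k) (hP : P.size ≤ X) (hkX : k ≤ X + 1) :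
    Fits P k (8 * (X + 1) ^ 2) := by
  have hdm : P.dim + P.numIneq ≤ X := by unfold HRep.size at hP; omega
  have h1 : P.numIneq * (P.dim + 1) ≤ X * (X + 1) := Nat.mul_le_mul (by omega) (by omega)
  refine ⟨hk, by nlinarith, ?_, by nlinarith⟩
  unfold HRep.cells
  nlinarith

theorem instrCount_le {d k X : ℕ} (hd : d ≤ X) (hk : k ≤ X + 1) :
    10 * (d + 1) + d * (11 * k + 17) + 25 ≤ 63 * (X + 1) ^ 2 := by
  have : d * (11 * k + 17) ≤ X * (11 * (X + 1) + 17) := Nat.mul_le_mul hd (by omega)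
  nlinarith

end VertexCentroid

open VertexCentroid in
theorem mainTheorem6 :
    ∃ (M : VertexCentroid.Prog) (callBound timeBound : Polynomial ℕ),
      ∀ O : VertexCentroid.HRep → ℕ, VertexCentroid.IsVertexCountOracle O →
        ∀ (P : VertexCentroid.HRep) (ε : ℚ), 0 < ε →
          P.toSet.Nonempty → P.toSet ⊆ Set.Icc 0 1 →
          ∃ (s : VertexCentroid.State) (t q : ℕ) (p : Fin P.dim → ℚ),
            VertexCentroid.Exec O M (VertexCentroid.initState P ε) s t q ∧
            s.Outputs p ∧
            P.IsCentroidApprox ε p ∧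
            q ≤ callBound.eval (P.numIneq + P.dim + ⌈1 / ε⌉₊) ∧
            t ≤ timeBound.eval (P.size + VertexCentroid.lenRat ε + ⌈1 / ε⌉₊) := by
  -- The first polynomial dominates `2 * d * k + 1`, with `k ≤ ⌈1/ε⌉₊ + 1`. The second is the bound
  -- on the number of instructions times `unitCost L` for `L = 8 * (X + 1) ^ 2`.
  refine ⟨block centroidProg, 2 * Polynomial.X * (Polynomial.X + 1) + 1,
    63 * (Polynomial.X + 1) ^ 2 * (8 * (8 * (Polynomial.X + 1) ^ 2 + 1) ^ 2), ?_⟩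
  intro O hO P ε hε hne hP
  have hpoly : P.IsPolytope := (Metric.isBounded_Icc 0 1).subset hP
  have hN := HRep.ncard_vertices_pos hpoly hne
  have hnum : 0 < ε.num := Rat.num_pos.2 hε
  have hquot : 0 ≤ (ε.den : ℤ) / ε.num := Int.ediv_nonneg (Int.natCast_nonneg _) hnum.le
  -- Adding 1 makes `k` positive even for `ε > 1` and gives `1 / k ≤ ε`.
  obtain ⟨k, hk⟩ : ∃ k : ℕ, (k : ℤ) = ε.den / ε.num + 1 := Int.eq_ofNat_of_zero_le (by omega)
    |>.imp fun _ h => h.symm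
  have hk0 : 0 < k := by omega
  have hinv : 1 / ε = (ε.den : ℚ) / (ε.num : ℚ) := by
    rw [one_div, ← Rat.num_div_den ε, inv_div, Rat.num_div_den]
  have hnumQ : (0 : ℚ) < ε.num := by exact_mod_cast hnum
  have hkceil : k ≤ ⌈1 / ε⌉₊ + 1 := by
    have h1 : ((ε.den : ℤ) / ε.num) * ε.num ≤ ε.den := Int.ediv_mul_le _ hnum.ne'
    have h2 : (((ε.den : ℤ) / ε.num : ℤ) : ℚ) ≤ 1 / ε := by
      rw [hinv, le_div_iff₀ hnumQ]
      exact_mod_cast h1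
    have h3 : (((ε.den : ℤ) / ε.num : ℤ) : ℚ) ≤ ((⌈1 / ε⌉₊ : ℤ) : ℚ) := by
      exact_mod_cast h2.trans (Nat.le_ceil _)
    have h4 := Int.cast_le.1 h3
    omega
  have hkinv : 1 / (k : ℚ) ≤ ε := by
    have h1 : (ε.den : ℤ) < k * ε.num := by
      rw [hk]
      exact Int.lt_ediv_add_one_mul_self _ hnum
    have h2 : 1 / ε ≤ k := by
      rw [hinv, div_le_iff₀ hnumQ]
      exact_mod_cast h1.le
    exact (one_div_le hε (by exact_mod_cast hk0)).1 h2
  have hfits := fits_of_size_le (P := P) (X := P.size + lenRat ε + ⌈1 / ε⌉₊) hk0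
    (by omega) (by omega)
  have hcount := instrCount_le (d := P.dim) (k := k) (X := P.size + lenRat ε + ⌈1 / ε⌉₊)
    (by unfold HRep.size; omega) (by omega)
  have hεL : lenRat ε ≤ 8 * (P.size + lenRat ε + ⌈1 / ε⌉₊ + 1) ^ 2 := by
    have := Nat.le_self_pow two_ne_zero (P.size + lenRat ε + ⌈1 / ε⌉₊ + 1)
    omega
  obtain ⟨s, t, q, hexec, ht, hq, hs0, hout⟩ :=
    runs_centroidProg hO hpoly hfits hεL hk
  -- The output fractions need not be reduced; all share the denominator `k * N`, which is positive
  -- because a nonempty polytope has a vertex.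
  refine ⟨s, t, q, fun j => (P.partialCount k j 0 : ℚ) / (k * P.vertices.ncard : ℕ), hexec,
    fun j => ?_, fun j => ?_, ?_, ?_⟩
  · have h0 : (s.reg 0).toNat = P.cells + 4 * (P.dim + 1) := by rw [hs0]; rfl
    obtain ⟨h1, h2⟩ := hout j (Nat.zero_le _)
    rw [State.readRat, h0, h1, h2]
    exact ⟨by exact_mod_cast Nat.mul_pos hk0 hN, by simp⟩
  · have h1 := HRep.abs_countGe_sub_centroid_le hne hP hk0 j
    have h2 : 1 / (k : ℝ) ≤ ε := by
      have : ((1 / (k : ℚ) : ℚ) : ℝ) ≤ ε := Rat.cast_le.2 hkinv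
      simpa using this
    refine le_trans (le_of_eq ?_) (h1.trans h2)
    push_cast [HRep.partialCount]
    rfl
  · refine hq.trans ?_
    simp only [Polynomial.eval_add, Polynomial.eval_mul, Polynomial.eval_X, Polynomial.eval_one,
      Polynomial.eval_ofNat]
    have : P.dim * (2 * k) ≤ (P.numIneq + P.dim + ⌈1 / ε⌉₊)
        * (2 * (P.numIneq + P.dim + ⌈1 / ε⌉₊ + 1)) := Nat.mul_le_mul (by omega) (by omega)
    nlinarith
  · refine ht.trans ((Nat.mul_le_mul_right _ hcount).trans (le_of_eq ?_))
    simp only [Polynomial.eval_add, Polynomial.eval_mul, Polynomial.eval_pow, Polynomial.eval_X,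
      Polynomial.eval_one, Polynomial.eval_ofNat, unitCost]
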